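/- **Conventions.** A relational signature is a set of relation symbols, each with an arity in $\mathbb N$; all signatures of sentences are finite. Structures are relational, and their domain is an arbitrary set. For a structure $\mathfrak B$ we write $\mathfrak B^{\tau}$ for its $\tau$-reduct, $\mathrm{Age}(\mathfrak B)$ for the class of all finite structures that embed into $\mathfrak B$, and $\mathrm{CSP}(\mathfrak B)$ for the class of all finite structures that have a homomorphism to $\mathfrak B$. For a class $\mathcal K$ of structures, $\mathcal K^{<}$ is the class of all expansions of structures in $\mathcal K$ by a (strict) linear order $<$. An *SNP $\tau$-sentence* is $\Phi=\exists X_1,\dots,X_r\,\forall x_1,\dots,x_m.\,\phi$ with $\phi$ a quantifier-free CNF-formula (equalities allowed) over $\tau\cup\sigma$, $\sigma=\{X_1,\dots,X_r\}$. It is a *GMSNP sentence* if (monotonicity) the only atoms that occur positively in clauses are $\sigma$-atoms, and (guarding) for every positive atom $X_i(\bar x)$ of a clause the same clause contains a negative atom $\neg R(\bar y)$, $R\in\tau\cup\sigma$, such that every entry of $\bar x$ is an entry of $\bar y$. It is *connected* if for every clause $\psi$ the structure on the variables of $\psi$ in which $R(\bar t)$ holds iff $\neg R(\bar t)$ is a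 disjunct of $\psi$ ($R \in \tau\cup\sigma$) is not the union of two structures with disjoint non-empty domains. Let $\mathrm{fm}(\Phi)$ be the class of finite models of $\Phi$ (finite $\tau$-structures), $\mathrm{efm}(\Phi)$ the class of finite models of the first-order part $\forall\bar x.\,\phi$ (finite $\tau\cup\sigma$-structures), and $\mathrm{ar}(\Phi)$ the maximal arity of a symbol in $\tau\cup\sigma$. **Recolouring-readiness.** A countable structure is *$\omega$-categorical* if its automorphism group has finitely many orbits of $k$-tuples for every $k\ge 1$. An $\omega$-categorical structure is *Ramsey* if the age $\mathcal K$ of its expansion by all first-order definable relations has the Ramsey property: for all $\mathfrak A,\mathfrak B\in\mathcal K$ and $r\in\mathbb N$ there is $\mathfrak W\in\mathcal K$ such that for every colouring of the embeddings $\mathfrak A\hookrightarrow\mathfrak W$ with $r$ colours there is an embedding $e:\mathfrak B\hookrightarrow\mathfrak W$ such that all embeddings $e\circ u$ with $u:\mathfrak A\hookrightarrow\mathfrak B$ have the same colour. A structure $\mathfrak B$ whose signature contains $\tau$ is *$\tau$-edge-homogeneous* if for every $R\in\tau$ any two tuples $\bar s,\bar t\in R^{\mathfrak B}$ lie in the same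 orbit if and only if $s_i\mapsto t_i$ is an isomorphism between the substructures of $\mathfrak B$ induced on their entries. A connected GMSNP $\tau$-sentence $\Phi$ is *recolouring-ready* if there are a $\tau\cup\sigma$-structure $\mathfrak C$ and a linear order $<$ on its domain such that $(\mathfrak C,<)$ is $\tau$-edge-homogeneous, $\omega$-categorical and Ramsey, and (i) $\mathrm{Age}(\mathfrak C,<)=\mathrm{Age}(\mathfrak C)^{<}$, (ii) $\mathrm{Age}(\mathfrak C)=\mathrm{efm}(\Phi)$, (iii) $\mathrm{Age}(\mathfrak C^{\tau})=\mathrm{CSP}(\mathfrak C^{\tau})=\mathrm{fm}(\Phi)$. **Recolourings.** Let $\Phi_1,\Phi_2$ be GMSNP $\tau$-sentences and $n=\max(\mathrm{ar}(\Phi_1),\mathrm{ar}(\Phi_2))$. A structure with domain $A$ is *$\tau$-guarded* if some tuple in some $\tau$-relation has all elements of $A$ among its entries. Let $\mathcal T_i$ be the set of all $\tau$-guarded structures in $\mathrm{efm}(\Phi_i)^{<}$ whose domain is $\{1,\dots,k\}$ for some $k\le n$ and whose order is $1<\dots<k$. A *GMSNP-recolouring* from $\Phi_1$ to $\Phi_2$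 is a map $\xi:\mathcal T_1\to\mathcal T_2$ such that 1. $\xi(\mathfrak T)^{\tau}=\mathfrak T^{\tau}$ for every $\mathfrak T\in\mathcal T_1$; 2. for every $\mathfrak A\in\mathrm{efm}(\Phi_1)^{<}$ there is a structure $\xi'(\mathfrak A)\in\mathrm{efm}(\Phi_2)^{<}$ with the same domain and the same order as $\mathfrak A$ such that for every $\mathfrak T\in\mathcal T_1$ every embedding of $\mathfrak T$ into $\mathfrak A$ is also an embedding of $\xi(\mathfrak T)$ into $\xi'(\mathfrak A)$. **Proposition.** Let $\tau$ be a finite relational signature and let $\Phi_1$ and $\Phi_2$ be connected recolouring-ready GMSNP $\tau$-sentences. Then $\mathrm{fm}(\Phi_1)\subseteq\mathrm{fm}(\Phi_2)$ if and only if there is a GMSNP-recolouring from $\Phi_1$ to $\Phi_2$. -/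

import Mathlib

namespace GMSNP

open FirstOrder FirstOrder.Language

/-!
Relational signatures are relational languages in the sense of Mathlib; structures, homomorphisms,
embeddings, ages and reducts are those of Mathlib. A class of structures is a set of bundled
structures. The union `τ ∪ σ` of disjoint signatures is `τ.sum σ`.
-/

section Structures

/-- The reduct of a structure along an inclusion of signatures. -/
def reduct {L L' : FirstOrder.Language.{0, 0}} (φ : L →ᴸ L')
    (A : CategoryTheory.Bundled.{0} L'.Structure) :
    CategoryTheory.Bundled.{0} L.Structure :=
  ⟨A, φ.reduct A⟩

/-- The only symbol of the signature of strict orders. -/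
inductive LTSymbol : ℕ → Type
  | lt : LTSymbol 2

/-- The signature with one binary symbol `<` and nothing else. -/
abbrev ltLang : FirstOrder.Language.{0, 0} := ⟨fun _ => Empty, LTSymbol⟩

/-- The signature `L ∪ {<}`. -/
abbrev withLT (L : FirstOrder.Language.{0, 0}) : FirstOrder.Language.{0, 0} := L.sum ltLang

/-- The inclusion of `L` into `L ∪ {<}`. -/
abbrev toLT (L : FirstOrder.Language.{0, 0}) : L →ᴸ withLT L := LHom.sumInl

/-- The interpretation of the symbol `<` in an `L ∪ {<}`-structure. -/
def ltRel {L : FirstOrder.Language.{0, 0}} {A : Type} (S : (withLT L).Structure A) (a b : A) : Prop :=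
  S.RelMap (Sum.inr LTSymbol.lt) ![a, b]

/-- `K^<`: the class of all linear-order expansions of structures in `K`. -/
def linOrdExpansions {L : FirstOrder.Language.{0, 0}} (K : Set (CategoryTheory.Bundled.{0} L.Structure)) :
    Set (CategoryTheory.Bundled.{0} (withLT L).Structure) :=
  {A | reduct (toLT L) A ∈ K ∧ IsStrictTotalOrder A (ltRel A.str)}

/-- The constraint satisfaction problem of `B`: the class of all finite structures that map
homomorphically to `B`. -/
def CSP {L : FirstOrder.Language.{0, 0}} (B : CategoryTheory.Bundled.{0} L.Structure) :
    Set (CategoryTheory.Bundled.{0} L.Structure) :=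
  {A | Finite A ∧ Nonempty (A →[L] B)}

/-- The age of a structure. In a relational signature, finitely generated means finite. -/
abbrev age {L : FirstOrder.Language.{0, 0}} (B : CategoryTheory.Bundled.{0} L.Structure) :
    Set (CategoryTheory.Bundled.{0} L.Structure) :=
  L.age B

theorem mem_age_iff {L : FirstOrder.Language.{0, 0}} [L.IsRelational]
    (A B : CategoryTheory.Bundled.{0} L.Structure) :
    A ∈ age B ↔ Finite A ∧ Nonempty (A ↪[L] B) := by
  change (Structure.FG L A ∧ _) ↔ _
  rw [Structure.fg_iff_finite]

/-- A structure is connected if it is not the union of two structures whose domains `P` and `Pᶜ`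
are disjoint and non-empty, that is, for no such `P` every tuple in a relation is a tuple over `P`
or a tuple over `Pᶜ`. -/
def IsConnectedStructure {L : FirstOrder.Language.{0, 0}} {A : Type} (S : L.Structure A) : Prop :=
  ¬ ∃ P : Set A, P.Nonempty ∧ Pᶜ.Nonempty ∧
    ∀ (k : ℕ) (R : L.Relations k) (t : Fin k → A), S.RelMap R t →
      Set.range t ⊆ P ∨ Set.range t ⊆ Pᶜ

/-- The largest arity of a symbol of a finite relational signature (`0` if there is none). -/
noncomputable def maxArity (L : FirstOrder.Language.{0, 0}) : ℕ :=
  sSup {k | Nonempty (L.Relations k)}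

end Structures

section ModelTheory

variable {L : FirstOrder.Language.{0, 0}}

/-- Two `k`-tuples lie in the same orbit of the automorphism group. -/
def SameOrbit (B : CategoryTheory.Bundled.{0} L.Structure) {k : ℕ} (s t : Fin k → B) : Prop :=
  ∃ g : B ≃[L] B, ∀ i, g (s i) = t i

/-- The map sending the `i`-th entry of `s` to the `i`-th entry of `t`, for all `i`, is a
(well defined) isomorphism between the substructures induced on the entries of `s` and of `t`. -/
def IsPartialIso (B : CategoryTheory.Bundled.{0} L.Structure) {k : ℕ} (s t : Fin k → B) : Prop :=
  (∀ i j, s i = s j ↔ t i = t j) ∧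
    ∀ (m : ℕ) (R : L.Relations m) (v : Fin m → Fin k),
      B.str.RelMap R (s ∘ v) ↔ B.str.RelMap R (t ∘ v)

/-- The homogeneity condition restricted to tuples that belong to a relation with symbol in `τ`;
`φ` is the inclusion of `τ` in the signature of `B`. -/
def IsEdgeHomogeneous {τ : FirstOrder.Language.{0, 0}} (φ : τ →ᴸ L)
    (B : CategoryTheory.Bundled.{0} L.Structure) : Prop :=
  ∀ (k : ℕ) (R : τ.Relations k) (s t : Fin k → B),
    B.str.RelMap (φ.onRelation R) s → B.str.RelMap (φ.onRelation R) t →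
      (SameOrbit B s t ↔ IsPartialIso B s t)

/-- A countable structure with finitely many orbits of `k`-tuples for every `k ≥ 1`. -/
def IsOmegaCategorical (B : CategoryTheory.Bundled.{0} L.Structure) : Prop :=
  Countable B ∧
    ∀ k : ℕ, 1 ≤ k → (Set.range fun s : Fin k → B => {t | SameOrbit B s t}).Finite

/-- The Ramsey property of a class of finite structures (for colourings of embeddings). -/
def HasRamseyProperty (K : Set (CategoryTheory.Bundled.{0} L.Structure)) : Prop :=
  ∀ A ∈ K, ∀ B ∈ K, ∀ r : ℕ, ∃ W ∈ K, ∀ f : (A ↪[L] W) → Fin r,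
    ∃ e : B ↪[L] W, ∀ u v : A ↪[L] B, f (e.comp u) = f (e.comp v)

/-- The signature with one symbol for each relation on `B` that is first-order definable in `B`
without parameters. -/
abbrev definableLang (B : CategoryTheory.Bundled.{0} L.Structure) : FirstOrder.Language.{0, 0} :=
  ⟨fun _ => Empty, fun k => {R : Set (Fin k → B) // (∅ : Set B).Definable L R}⟩

instance definableStructure (B : CategoryTheory.Bundled.{0} L.Structure) :
    (definableLang B).Structure B where
  funMap f := f.elim
  RelMap R t := t ∈ R.1

/-- The expansion of `B` by all first-order definable relations. -/
def definableExpansion (B : CategoryTheory.Bundled.{0} L.Structure) :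
    CategoryTheory.Bundled.{0} (L.sum (definableLang B)).Structure :=
  ⟨B, inferInstance⟩

/-- An (`ω`-categorical) structure is Ramsey if the age of its expansion by all first-order
definable relations has the Ramsey property. -/
def IsRamsey (B : CategoryTheory.Bundled.{0} L.Structure) : Prop :=
  HasRamseyProperty (age (definableExpansion B))

end ModelTheory

section Sentences

/-- Atomic formulas (equalities included) over the signature `L` with variables in `V`. -/
inductive Atom (L : FirstOrder.Language.{0, 0}) (V : Type) : Type
  | eq (x y : V) : Atom L V
  | rel {k : ℕ} (R : L.Relations k) (t : Fin k → V) : Atom L V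

/-- A literal: an atom, or the negation of an atom. -/
inductive Literal (L : FirstOrder.Language.{0, 0}) (V : Type) : Type
  | pos (a : Atom L V) : Literal L V
  | neg (a : Atom L V) : Literal L V

/-- A clause: the disjunction of the literals in a finite list. -/
abbrev Clause (L : FirstOrder.Language.{0, 0}) (V : Type) : Type := List (Literal L V)

namespace Atom

variable {L : FirstOrder.Language.{0, 0}} {V : Type}

/-- The variables of an atom. -/
def vars : Atom L V → Set V
  | eq x y => {x, y}
  | rel _ t => Set.range t

/-- Truth of an atom in a structure under an assignment of the variables. -/
def Holds {A : Type} (S : L.Structure A) (v : V → A) : Atom L V → Prop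
  | eq x y => v x = v y
  | rel R t => S.RelMap R (v ∘ t)

end Atom

namespace Literal

variable {L : FirstOrder.Language.{0, 0}} {V : Type}

/-- The variables of a literal. -/
def vars : Literal L V → Set V
  | pos a => a.vars
  | neg a => a.vars

/-- Truth of a literal in a structure under an assignment of the variables. -/
def Holds {A : Type} (S : L.Structure A) (v : V → A) : Literal L V → Prop
  | pos a => a.Holds S v
  | neg a => ¬ a.Holds S v

end Literal

namespace Clause

variable {L : FirstOrder.Language.{0, 0}} {V : Type}

/-- The variables of a clause. -/
def vars (ψ : Clause L V) : Set V := {x | ∃ l ∈ ψ, x ∈ l.vars}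

/-- Truth of a clause in a structure under an assignment of the variables. -/
def Holds {A : Type} (S : L.Structure A) (v : V → A) (ψ : Clause L V) : Prop :=
  ∃ l ∈ ψ, l.Holds S v

/-- The structure whose domain consists of the variables of the clause `ψ` and in which `R(t)`
holds if and only if `¬ R(t)` is a disjunct of `ψ`. -/
@[reducible] def toStructure [L.IsRelational] (ψ : Clause L V) : L.Structure ψ.vars where
  funMap f := isEmptyElim f
  RelMap R t := Literal.neg (Atom.rel R fun i => (t i : V)) ∈ ψ

end Clause

/-- An SNP `τ`-sentence `∃ X₁, …, Xₙ ∀ x₁, …, xₘ. φ` with existential symbols `σ = {X₁, …, Xₙ}`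
and `φ` a CNF-formula over `τ ∪ σ`, given by the list of its clauses. -/
structure SNPSentence (τ σ : FirstOrder.Language.{0, 0}) : Type where
  numVars : ℕ
  clauses : List (Clause (τ.sum σ) (Fin numVars))

namespace SNPSentence

variable {τ σ : FirstOrder.Language.{0, 0}}

/-- The first-order part `∀ x₁, …, xₘ. φ` holds in a `τ ∪ σ`-structure. -/
def FirstOrderPart (Φ : SNPSentence τ σ) {A : Type} (S : (τ.sum σ).Structure A) : Prop :=
  ∀ v : Fin Φ.numVars → A, ∀ ψ ∈ Φ.clauses, ψ.Holds S v

/-- The class of all finite models of the first-order part. -/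
def efm (Φ : SNPSentence τ σ) : Set (CategoryTheory.Bundled.{0} (τ.sum σ).Structure) :=
  {A | Finite A ∧ Φ.FirstOrderPart A.str}

/-- The class of all finite models: the finite `τ`-structures with an expansion by
`σ`-relations that satisfies the first-order part. -/
def fm (Φ : SNPSentence τ σ) : Set (CategoryTheory.Bundled.{0} τ.Structure) :=
  {A | Finite A ∧ ∃ S : (τ.sum σ).Structure A,
    @LHom.reduct τ (τ.sum σ) LHom.sumInl A S = A.str ∧ Φ.FirstOrderPart S}

/-- The largest arity of a relation symbol of the sentence, that is, of a symbol in `τ ∪ σ`. -/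
noncomputable def ar (_Φ : SNPSentence τ σ) : ℕ := maxArity (τ.sum σ)

/-- Monotonicity: the only atoms that occur positively in clauses are `σ`-atoms. -/
def IsMonotone (Φ : SNPSentence τ σ) : Prop :=
  ∀ ψ ∈ Φ.clauses, ∀ a, Literal.pos a ∈ ψ →
    ∃ (k : ℕ) (X : σ.Relations k) (t : Fin k → Fin Φ.numVars), a = Atom.rel (Sum.inr X) t

/-- Guarding: for every positive atom `X(x̄)` of a clause, the clause has a negative
`τ ∪ σ`-atom `¬ R(ȳ)` such that all entries of `x̄` are entries of `ȳ`. -/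
def IsGuarding (Φ : SNPSentence τ σ) : Prop :=
  ∀ ψ ∈ Φ.clauses, ∀ (k : ℕ) (X : σ.Relations k) (x : Fin k → Fin Φ.numVars),
    Literal.pos (Atom.rel (Sum.inr X) x) ∈ ψ →
      ∃ (m : ℕ) (R : (τ.sum σ).Relations m) (y : Fin m → Fin Φ.numVars),
        Literal.neg (Atom.rel R y) ∈ ψ ∧ Set.range x ⊆ Set.range y

/-- A GMSNP sentence is an SNP sentence that satisfies monotonicity and guarding. -/
def IsGMSNP (Φ : SNPSentence τ σ) : Prop := Φ.IsMonotone ∧ Φ.IsGuarding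

/-- A sentence is connected if the structure of each of its clauses is connected. -/
def IsConnected [τ.IsRelational] [σ.IsRelational] (Φ : SNPSentence τ σ) : Prop :=
  ∀ ψ ∈ Φ.clauses, IsConnectedStructure (Clause.toStructure ψ)

/-- The inclusion of `τ` into `τ ∪ σ ∪ {<}`. -/
abbrev inclLT (τ σ : FirstOrder.Language.{0, 0}) : τ →ᴸ withLT (τ.sum σ) :=
  (toLT (τ.sum σ)).comp LHom.sumInl

/-- Recolouring-readiness. The structure `C` is the linear-order expansion of `C_Φ`, and
`C_Φ = reduct (toLT (τ.sum σ)) C`. -/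
def IsRecolouringReady (Φ : SNPSentence τ σ) : Prop :=
  ∃ C : CategoryTheory.Bundled.{0} (withLT (τ.sum σ)).Structure,
    IsStrictTotalOrder C (ltRel C.str) ∧
    IsEdgeHomogeneous (inclLT τ σ) C ∧ IsOmegaCategorical C ∧ IsRamsey C ∧
    age C = linOrdExpansions (age (reduct (toLT (τ.sum σ)) C)) ∧
    age (reduct (toLT (τ.sum σ)) C) = Φ.efm ∧
    age (reduct (inclLT τ σ) C) = CSP (reduct (inclLT τ σ) C) ∧
    CSP (reduct (inclLT τ σ) C) = Φ.fm

end SNPSentence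

end Sentences

section Recolourings

variable {τ σ : FirstOrder.Language.{0, 0}}

/-- `A` is `τ`-guarded: some tuple in a relation with symbol in `τ` has every element of `A`
among its entries; `φ` is the inclusion of `τ` in the signature of `A`. -/
def IsGuardedStructure {L : FirstOrder.Language.{0, 0}} (φ : τ →ᴸ L) {A : Type} (S : L.Structure A) : Prop :=
  ∃ (k : ℕ) (R : τ.Relations k) (t : Fin k → A),
    S.RelMap (φ.onRelation R) t ∧ ∀ a, a ∈ Set.range t

/-- The standardly ordered `τ`-guarded structures of size `k` among the linear-order expansions
of the `n`-colours of `Φ`: their domain is `{1, …, k}` with `k ≤ n`, here `Fin k`, with the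
natural order. -/
structure OrderedColour (Φ : SNPSentence τ σ) (n k : ℕ) : Type where
  str : (withLT (τ.sum σ)).Structure (Fin k)
  size_le : k ≤ n
  mem : (⟨Fin k, str⟩ : CategoryTheory.Bundled.{0} (withLT (τ.sum σ)).Structure) ∈
    linOrdExpansions Φ.efm
  standard : ∀ i j : Fin k, ltRel str i j ↔ i < j
  guarded : IsGuardedStructure (SNPSentence.inclLT τ σ) str

/-- The function `f` is an embedding between the given structures. -/
def IsEmbedding {L : FirstOrder.Language.{0, 0}} {A B : Type} (S : L.Structure A) (S' : L.Structure B)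
    (f : A → B) : Prop :=
  ∃ e : A ↪[L] B, ⇑e = f

variable {σ₁ σ₂ : FirstOrder.Language.{0, 0}}

/-- Maps from standardly ordered `τ`-guarded `n`-colours of `Φ₁` to those of `Φ₂`,
`n = max (ar Φ₁) (ar Φ₂)`. Since a recolouring does not change `τ`-reducts, it does not change
domains, so that the image of a colour with domain `Fin k` has domain `Fin k`. -/
abbrev ColourMap (Φ₁ : SNPSentence τ σ₁) (Φ₂ : SNPSentence τ σ₂) : Type :=
  ∀ k : ℕ, OrderedColour Φ₁ (max Φ₁.ar Φ₂.ar) k → OrderedColour Φ₂ (max Φ₁.ar Φ₂.ar) k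

/-- A map of colours is a GMSNP-recolouring if it does not change `τ`-reducts and if every
`A` in `efm(Φ₁)^<` has a counterpart `S'` in `efm(Φ₂)^<` on the same domain and with the same
order, such that every embedding of a colour `T` into `A` is an embedding of `ξ(T)` into `S'`. -/
def IsGMSNPRecolouring (Φ₁ : SNPSentence τ σ₁) (Φ₂ : SNPSentence τ σ₂) (ξ : ColourMap Φ₁ Φ₂) :
    Prop :=
  (∀ (k : ℕ) (T : OrderedColour Φ₁ (max Φ₁.ar Φ₂.ar) k),
    @LHom.reduct _ _ (SNPSentence.inclLT τ σ₂) (Fin k) (ξ k T).str =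
      @LHom.reduct _ _ (SNPSentence.inclLT τ σ₁) (Fin k) T.str) ∧
  ∀ A ∈ linOrdExpansions Φ₁.efm, ∃ S' : (withLT (τ.sum σ₂)).Structure A,
    (⟨A, S'⟩ : CategoryTheory.Bundled.{0} (withLT (τ.sum σ₂)).Structure) ∈
      linOrdExpansions Φ₂.efm ∧
    (∀ a b : A, ltRel A.str a b ↔ ltRel S' a b) ∧
    ∀ (k : ℕ) (T : OrderedColour Φ₁ (max Φ₁.ar Φ₂.ar) k) (e : Fin k → A),
      IsEmbedding T.str A.str e → IsEmbedding (ξ k T).str S' e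

end Recolourings

end GMSNP

/-! Containment to recolouring: fix an ordered model `A` of the first-order part of `Φ₁`. Readiness
puts it in the age of an edge-homogeneous Ramsey structure. Edge-homogeneity gives every colour a
canonical expansion by the definable relations, so the Ramsey property, stated for that expansion,
applies to colours themselves (`IsRamsey.exists_forall_guarded`) and yields a large model `W`. By
containment `W` carries an expansion for `Φ₂`; each copy of a colour in `W` is coloured by the
`Φ₂`-structure induced on it. On a suitable copy of `A` in `W` that structure depends on the colour
alone, which defines a recolouring for `A` (`exists_recolouringWorksFor`). A single map then serves
all `A`: there are finitely many candidates, and counterexamples to all of them would embed jointly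
into one model, for which some candidate works.

Recolouring to containment: order a model of `Φ₁` arbitrarily and recolour it. Every `τ`-tuple lies
in a colour and so survives, which makes the identity a homomorphism to a model of `Φ₂`; and
`Φ₂.fm`, being a CSP, is closed under homomorphic preimages. -/

namespace GMSNP

open FirstOrder FirstOrder.Language

/-! ### Embeddings, ages and finiteness. -/

section Embeddings

variable {L : FirstOrder.Language.{0, 0}}

instance isRelational_ltLang : ltLang.IsRelational := fun _ => inferInstanceAs (IsEmpty Empty)

instance isRelational_definableLang (B : CategoryTheory.Bundled.{0} L.Structure) :
    (definableLang B).IsRelational := fun _ => inferInstanceAs (IsEmpty Empty)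

/-- The structure induced along a map, in a relational signature. -/
@[reducible] def pullback [L.IsRelational] {A B : Type} (S : L.Structure B) (f : A → B) : L.Structure A where
  funMap g := isEmptyElim g
  RelMap R t := S.RelMap R (f ∘ t)

theorem structure_ext [L.IsRelational] {A : Type} {S S' : L.Structure A}
    (h : ∀ (k : ℕ) (R : L.Relations k) (t : Fin k → A), S.RelMap R t ↔ S'.RelMap R t) :
    S = S' := by
  apply Structure.ext
  · funext k g
    exact isEmptyElim g
  · funext k R t
    exact propext (h k R t)

theorem isEmbedding_iff [L.IsRelational] {A B : Type} {S : L.Structure A} {S' : L.Structure B}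
    {f : A → B} :
    IsEmbedding S S' f ↔ Function.Injective f ∧
      ∀ (k : ℕ) (R : L.Relations k) (t : Fin k → A), S'.RelMap R (f ∘ t) ↔ S.RelMap R t := by
  constructor
  · rintro ⟨e, rfl⟩
    exact ⟨e.injective, fun k R t => e.map_rel R t⟩
  · rintro ⟨hf, h⟩
    exact ⟨{ toFun := f, inj' := hf, map_fun' := fun g => isEmptyElim g,
             map_rel' := fun R t => h _ R t }, rfl⟩

theorem isEmbedding_pullback [L.IsRelational] {A B : Type} (S : L.Structure B) {f : A → B}
    (hf : Function.Injective f) : IsEmbedding (pullback S f) S f :=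
  isEmbedding_iff.2 ⟨hf, fun _ _ _ => Iff.rfl⟩

theorem IsEmbedding.comp {A B D : Type} {S : L.Structure A} {S' : L.Structure B}
    {S'' : L.Structure D} {g : B → D} {f : A → B} (hg : IsEmbedding S' S'' g)
    (hf : IsEmbedding S S' f) : IsEmbedding S S'' (g ∘ f) := by
  obtain ⟨e, rfl⟩ := hg
  obtain ⟨e', rfl⟩ := hf
  exact ⟨e.comp e', rfl⟩

theorem IsEmbedding.injective {A B : Type} {S : L.Structure A} {S' : L.Structure B} {f : A → B}
    (hf : IsEmbedding S S' f) : Function.Injective f := by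
  obtain ⟨e, rfl⟩ := hf
  exact e.injective

theorem IsEmbedding.relMap_iff {A B : Type} {S : L.Structure A} {S' : L.Structure B} {f : A → B}
    (hf : IsEmbedding S S' f) {k : ℕ} (R : L.Relations k) (t : Fin k → A) :
    S'.RelMap R (f ∘ t) ↔ S.RelMap R t := by
  obtain ⟨e, rfl⟩ := hf
  exact e.map_rel R t

/-- Applied with `g` the map along which a structure was pulled back: a map into the induced
structure is tested in the ambient one. -/
theorem IsEmbedding.of_comp [L.IsRelational] {A B D : Type} {S : L.Structure A}
    {S' : L.Structure B} {S'' : L.Structure D} {g : B → D} {f : A → B}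
    (hg : IsEmbedding S' S'' g) (h : IsEmbedding S S'' (g ∘ f)) : IsEmbedding S S' f :=
  isEmbedding_iff.2 ⟨h.injective.of_comp, fun _ R t =>
    (hg.relMap_iff R (f ∘ t)).symm.trans (h.relMap_iff R t)⟩

theorem IsEmbedding.reduct {L' : FirstOrder.Language.{0, 0}} (φ : L →ᴸ L')
    {A B : Type} {S : L'.Structure A} {S' : L'.Structure B} {f : A → B}
    (hf : IsEmbedding S S' f) :
    IsEmbedding (@LHom.reduct _ _ φ A S) (@LHom.reduct _ _ φ B S') f := by
  obtain ⟨e, rfl⟩ := hf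
  refine ⟨@Embedding.mk _ _ _ (@LHom.reduct _ _ φ A S) (@LHom.reduct _ _ φ B S')
    e.toEmbedding ?_ ?_, rfl⟩
  · intro n g t
    exact e.map_fun (φ.onFunction g) t
  · intro n R t
    exact e.map_rel (φ.onRelation R) t

theorem mem_age_iff_isEmbedding [L.IsRelational] (A B : CategoryTheory.Bundled.{0} L.Structure) :
    A ∈ age B ↔ Finite A ∧ ∃ f : A → B, IsEmbedding A.str B.str f := by
  rw [mem_age_iff]
  exact and_congr_right fun _ => ⟨fun ⟨e⟩ => ⟨e, e, rfl⟩, fun ⟨_, e, _⟩ => ⟨e⟩⟩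

theorem IsEmbedding.ltRel_iff {A B : Type} {S : (withLT L).Structure A}
    {S' : (withLT L).Structure B} {f : A → B} (hf : IsEmbedding S S' f) (a b : A) :
    ltRel S' (f a) (f b) ↔ ltRel S a b := by
  have h := hf.relMap_iff (Sum.inr LTSymbol.lt) ![a, b]
  have hab : f ∘ ![a, b] = ![f a, f b] := by
    funext i
    fin_cases i <;> rfl
  rw [hab] at h
  exact h

/-- Finitely many members of an age embed jointly into a member of the age. -/
theorem exists_mem_age_forall_isEmbedding [L.IsRelational]
    (C : CategoryTheory.Bundled.{0} L.Structure) {ι : Type} [Finite ι]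
    (A : ι → CategoryTheory.Bundled.{0} L.Structure) (hA : ∀ i, A i ∈ age C) :
    ∃ B ∈ age C, ∀ i, ∃ f : A i → B, IsEmbedding (A i).str B.str f := by
  have h := fun i => (mem_age_iff_isEmbedding (A i) C).1 (hA i)
  choose hfin u hu using h
  -- All members lie in the same `C`, so the union of their finitely many finite images is again
  -- finite and contains a copy of each.
  let D : Set C := ⋃ i, Set.range (u i)
  have hD : D.Finite := Set.finite_iUnion fun i => Set.finite_range _
  have hval := isEmbedding_pullback C.str (f := (Subtype.val : D → C)) Subtype.val_injective
  refine ⟨⟨D, pullback C.str Subtype.val⟩, (mem_age_iff_isEmbedding _ _).2 ⟨hD, _, hval⟩, fun i => ?_⟩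
  refine ⟨fun a => ⟨u i a, Set.mem_iUnion.2 ⟨i, a, rfl⟩⟩, hval.of_comp ?_⟩
  exact hu i

theorem finite_structure [L.IsRelational] [Finite (Σ k : ℕ, L.Relations k)] (A : Type) [Finite A] :
    Finite (L.Structure A) := by
  let F : L.Structure A → ∀ p : (Σ k : ℕ, L.Relations k), Set (Fin p.1 → A) :=
    fun S p => {t | S.RelMap p.2 t}
  refine Finite.of_injective F fun S S' h => structure_ext fun k R t => ?_
  have := congrFun h ⟨k, R⟩
  exact Set.ext_iff.1 this t

theorem finite_relations_sum (L L' : FirstOrder.Language.{0, 0})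
    [Finite (Σ k : ℕ, L.Relations k)] [Finite (Σ k : ℕ, L'.Relations k)] :
    Finite (Σ k : ℕ, (L.sum L').Relations k) :=
  Finite.of_equiv _ (Equiv.sigmaSumDistrib L.Relations L'.Relations).symm

theorem finite_relations_ltLang : Finite (Σ k : ℕ, ltLang.Relations k) :=
  Finite.of_injective (β := Unit) (fun _ => ()) <| by
    rintro ⟨_, ⟨⟩⟩ ⟨_, ⟨⟩⟩ _
    rfl

theorem le_maxArity [Finite (Σ k : ℕ, L.Relations k)] {k : ℕ} (R : L.Relations k) :
    k ≤ maxArity L := by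
  refine le_csSup ?_ ⟨R⟩
  refine ((Set.finite_range fun p : Σ k : ℕ, L.Relations k => p.1).subset ?_).bddAbove
  rintro m ⟨R⟩
  exact ⟨⟨m, R⟩, rfl⟩

end Embeddings

section Order

variable {L : FirstOrder.Language.{0, 0}} [L.IsRelational]

/-- The expansion of a structure by a binary relation interpreting `<`. -/
@[reducible] def withOrder {A : Type} (S : L.Structure A) (r : A → A → Prop) : (withLT L).Structure A where
  funMap g := isEmptyElim g
  RelMap := fun {_} R => match R with
    | Sum.inl R => fun t => S.RelMap R t
    | Sum.inr LTSymbol.lt => fun t => r (t 0) (t 1)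

end Order

/-! ### Universal sentences under embeddings. -/

section Sentences

variable {L : FirstOrder.Language.{0, 0}} {V : Type}

theorem IsEmbedding.holds_atom_iff {A B : Type} {S : L.Structure A} {S' : L.Structure B}
    {f : A → B} (hf : IsEmbedding S S' f) (v : V → A) (a : Atom L V) :
    a.Holds S' (f ∘ v) ↔ a.Holds S v := by
  cases a with
  | eq x y => exact hf.injective.eq_iff
  | rel R t => exact hf.relMap_iff R (v ∘ t)

theorem IsEmbedding.holds_clause_iff {A B : Type} {S : L.Structure A} {S' : L.Structure B}
    {f : A → B} (hf : IsEmbedding S S' f) (v : V → A) (ψ : Clause L V) :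
    ψ.Holds S' (f ∘ v) ↔ ψ.Holds S v := by
  refine exists_congr fun l => and_congr_right fun _ => ?_
  cases l with
  | pos a => exact hf.holds_atom_iff v a
  | neg a => exact not_congr (hf.holds_atom_iff v a)

variable {τ σ : FirstOrder.Language.{0, 0}}

theorem SNPSentence.FirstOrderPart.of_isEmbedding {Φ : SNPSentence τ σ} {A B : Type}
    {S : (τ.sum σ).Structure A} {S' : (τ.sum σ).Structure B} {f : A → B}
    (h : Φ.FirstOrderPart S') (hf : IsEmbedding S S' f) : Φ.FirstOrderPart S :=
  fun v ψ hψ => (hf.holds_clause_iff v ψ).1 (h (f ∘ v) ψ hψ)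

/-- Universal sentences and strict total orders both restrict to substructures. -/
theorem mem_linOrdExpansions_efm_of_isEmbedding {Φ : SNPSentence τ σ}
    {A B : CategoryTheory.Bundled.{0} (withLT (τ.sum σ)).Structure}
    (hB : B ∈ linOrdExpansions Φ.efm) {f : A → B} (hf : IsEmbedding A.str B.str f) :
    A ∈ linOrdExpansions Φ.efm := by
  obtain ⟨⟨hfin, hFO⟩, hord⟩ := hB
  have : Finite B := hfin
  have hA : Finite A := Finite.of_injective f hf.injective
  refine ⟨⟨hA, hFO.of_isEmbedding (hf.reduct _)⟩, ?_⟩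
  let e : ltRel A.str ↪r ltRel B.str := ⟨⟨f, hf.injective⟩, fun {a b} => hf.ltRel_iff a b⟩
  exact { toTrichotomous := (RelEmbedding.trichotomous e)
          toIsStrictOrder := (RelEmbedding.isStrictOrder e) }

end Sentences

/-! ### Ramsey property for several colourings at once. -/

section Ramsey

variable {L : FirstOrder.Language.{0, 0}}

/-- The colouring is defined on all maps, although only its values on embeddings matter; this avoids
carrying bundled embeddings through the induction below. -/
theorem HasRamseyProperty.exists_isEmbedding {K : Set (CategoryTheory.Bundled.{0} L.Structure)}
    (hK : HasRamseyProperty K) {A B : CategoryTheory.Bundled.{0} L.Structure} (hA : A ∈ K)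
    (hB : B ∈ K) (X : Type) [Finite X] :
    ∃ W ∈ K, ∀ c : (A → W) → X, ∃ e : B → W, IsEmbedding B.str W.str e ∧
      ∀ u v : A → B, IsEmbedding A.str B.str u → IsEmbedding A.str B.str v →
        c (e ∘ u) = c (e ∘ v) := by
  obtain ⟨r, ⟨i⟩⟩ := Finite.exists_equiv_fin X
  obtain ⟨W, hW, h⟩ := hK A hA B hB r
  refine ⟨W, hW, fun c => ?_⟩
  obtain ⟨e, he⟩ := h fun u => i (c u)
  refine ⟨e, ⟨e, rfl⟩, ?_⟩
  rintro _ _ ⟨u, rfl⟩ ⟨v, rfl⟩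
  exact i.injective (he u v)

/-- The Ramsey property for simultaneous colourings of the embeddings of finitely many
structures. -/
theorem HasRamseyProperty.exists_forall_mem {K : Set (CategoryTheory.Bundled.{0} L.Structure)}
    (hK : HasRamseyProperty K) {ι : Type} (A : ι → CategoryTheory.Bundled.{0} L.Structure)
    (hA : ∀ i, A i ∈ K) (X : ι → Type) [∀ i, Finite (X i)] (l : List ι) :
    ∀ B ∈ K, ∃ W ∈ K, ∀ c : ∀ i, (A i → W) → X i, ∃ e : B → W, IsEmbedding B.str W.str e ∧
      ∀ i ∈ l, ∀ u v : A i → B, IsEmbedding (A i).str B.str u → IsEmbedding (A i).str B.str v →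
        c i (e ∘ u) = c i (e ∘ v) := by
  induction l with
  | nil => exact fun B hB => ⟨B, hB, fun c => ⟨id, ⟨Embedding.refl _ _, rfl⟩, by simp⟩⟩
  | cons j l ih =>
    intro B hB
    -- `W'` handles the tail and `W` is Ramsey for `W'`. The copy of `W'` in `W` is chosen first,
    -- and the tail colourings are then restricted to it; passing to a smaller copy of `B` keeps the
    -- colour of `A j` constant.
    obtain ⟨W', hW', h'⟩ := ih B hB
    obtain ⟨W, hW, h⟩ := hK.exists_isEmbedding (hA j) hW' (X j)
    refine ⟨W, hW, fun c => ?_⟩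
    obtain ⟨e, he, hce⟩ := h (c j)
    obtain ⟨e', he', hce'⟩ := h' fun i u => c i (e ∘ u)
    refine ⟨e ∘ e', he.comp he', fun i hi u v hu hv => ?_⟩
    rcases List.mem_cons.1 hi with rfl | hi
    · exact hce (e' ∘ u) (e' ∘ v) (he'.comp hu) (he'.comp hv)
    · exact hce' i hi u v hu hv

end Ramsey

/-! ### Definable relations and automorphisms. -/

section Definable

variable {L : FirstOrder.Language.{0, 0}}

/-- Automorphisms preserve the truth of first-order formulas, so they are also automorphisms of the
definable expansion. -/
theorem relMap_definableExpansion_comp_iff (C : CategoryTheory.Bundled.{0} L.Structure)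
    (g : C ≃[L] C) {k : ℕ} (R : (L.sum (definableLang C)).Relations k) (t : Fin k → C) :
    (definableExpansion C).str.RelMap R (g ∘ t) ↔ (definableExpansion C).str.RelMap R t := by
  rcases R with R | ⟨R, hR⟩
  · exact g.map_rel R t
  · obtain ⟨φ, rfl⟩ := Set.empty_definable_iff.1 hR
    exact StrongHomClass.realize_formula g φ

end Definable

end GMSNP

namespace GMSNP

open FirstOrder FirstOrder.Language

/-! ### Edge-homogeneity and Ramsey for guarded structures. -/

section EdgeHomogeneity

variable {τ L : FirstOrder.Language.{0, 0}}

/-- In an edge-homogeneous structure, all embeddings of a guarded structure lie in the same orbit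
of the automorphism group. -/
theorem IsEdgeHomogeneous.exists_equiv_comp_eq {φ : τ →ᴸ L}
    {C : CategoryTheory.Bundled.{0} L.Structure} (hC : IsEdgeHomogeneous φ C) {A : Type}
    {S : L.Structure A} (hS : IsGuardedStructure φ S) {u v : A → C} (hu : IsEmbedding S C.str u)
    (hv : IsEmbedding S C.str v) : ∃ g : C ≃[L] C, g ∘ u = v := by
  obtain ⟨k, R, t, hR, ht⟩ := hS
  have hiso : IsPartialIso C (u ∘ t) (v ∘ t) :=
    ⟨fun i j => hu.injective.eq_iff.trans hv.injective.eq_iff.symm,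
      fun m Q w => (hu.relMap_iff Q (t ∘ w)).trans (hv.relMap_iff Q (t ∘ w)).symm⟩
  obtain ⟨g, hg⟩ := (hC k R (u ∘ t) (v ∘ t) ((hu.relMap_iff _ t).2 hR)
    ((hv.relMap_iff _ t).2 hR)).2 hiso
  refine ⟨g, funext fun a => ?_⟩
  obtain ⟨i, rfl⟩ := ht a
  exact hg i

variable [L.IsRelational]

/-- The structure induced by the definable expansion along an embedding of a guarded structure
does not depend on the embedding. -/
theorem IsEdgeHomogeneous.pullback_definableExpansion_eq {φ : τ →ᴸ L}
    {C : CategoryTheory.Bundled.{0} L.Structure} (hC : IsEdgeHomogeneous φ C) {A : Type}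
    {S : L.Structure A} (hS : IsGuardedStructure φ S) {u v : A → C} (hu : IsEmbedding S C.str u)
    (hv : IsEmbedding S C.str v) :
    pullback (definableExpansion C).str u = pullback (definableExpansion C).str v := by
  obtain ⟨g, rfl⟩ := hC.exists_equiv_comp_eq hS hu hv
  exact structure_ext fun k R t => (relMap_definableExpansion_comp_iff C g R (u ∘ t)).symm

/-- Simultaneous colourings of the embeddings of finitely many guarded structures into members of
the age of an edge-homogeneous Ramsey structure. -/
theorem IsRamsey.exists_forall_guarded {φ : τ →ᴸ L}
    {C : CategoryTheory.Bundled.{0} L.Structure} (hR : IsRamsey C) (hC : IsEdgeHomogeneous φ C)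
    {ι : Type} [Finite ι] (T : ι → CategoryTheory.Bundled.{0} L.Structure)
    (hT : ∀ i, T i ∈ age C) (hg : ∀ i, IsGuardedStructure φ (T i).str)
    (X : ι → Type) [∀ i, Finite (X i)]
    (A : CategoryTheory.Bundled.{0} L.Structure) (hA : A ∈ age C) :
    ∃ W ∈ age C, ∀ c : ∀ i, (T i → W) → X i, ∃ e : A → W, IsEmbedding A.str W.str e ∧
      ∀ i, ∀ u v : T i → A, IsEmbedding (T i).str A.str u → IsEmbedding (T i).str A.str v →
        c i (e ∘ u) = c i (e ∘ v) := by
  have h := fun i => (mem_age_iff_isEmbedding (T i) C).1 (hT i)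
  choose hfin u hu using h
  obtain ⟨hAfin, a, ha⟩ := (mem_age_iff_isEmbedding A C).1 hA
  obtain ⟨l, hl⟩ := Finite.exists_univ_list ι
  obtain ⟨W, hW, h⟩ := HasRamseyProperty.exists_forall_mem hR
    (fun i => ⟨T i, pullback (definableExpansion C).str (u i)⟩)
    (fun i => (mem_age_iff_isEmbedding _ _).2 ⟨hfin i, u i, isEmbedding_pullback _ (hu i).injective⟩)
    X l ⟨A, pullback (definableExpansion C).str a⟩
    ((mem_age_iff_isEmbedding _ _).2 ⟨hAfin, a, isEmbedding_pullback _ ha.injective⟩)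
  obtain ⟨hWfin, w, hw⟩ := (mem_age_iff_isEmbedding _ _).1 hW
  -- Forgetting the definable relations recovers the original structure.
  have hpull : ∀ {B : Type} {S : L.Structure B} {f : B → C}, IsEmbedding S C.str f →
      S = @LHom.reduct _ _ LHom.sumInl B (pullback (definableExpansion C).str f) := fun hf =>
    structure_ext fun k R t => (hf.relMap_iff R t).symm
  refine ⟨⟨W, @LHom.reduct _ _ LHom.sumInl W W.str⟩,
    (mem_age_iff_isEmbedding _ _).2 ⟨hWfin, w, hw.reduct LHom.sumInl⟩, fun c => ?_⟩
  obtain ⟨e, he, hce⟩ := h c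
  refine ⟨e, ?_, fun i f f' hf hf' => ?_⟩
  · rw [hpull ha]
    exact he.reduct LHom.sumInl
  -- Guardedness enters here: `a ∘ f` and `u i` induce the same definable relations on `T i`, so no
  -- copy of `T i` in `A` is lost in the expansion.
  · have key : ∀ f : T i → A, IsEmbedding (T i).str A.str f →
        IsEmbedding (pullback (definableExpansion C).str (u i))
          (pullback (definableExpansion C).str a) f := fun f hf => by
      rw [hC.pullback_definableExpansion_eq (hg i) (hu i) (ha.comp hf)]
      exact isEmbedding_iff.2 ⟨hf.injective, fun _ _ _ => Iff.rfl⟩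
    exact hce i (hl.2 i) f f' (key f hf) (key f' hf')

end EdgeHomogeneity

/-! ### From containment to a recolouring. -/

section Recolourings

variable {τ σ₁ σ₂ : FirstOrder.Language.{0, 0}}

/-- The recolouring condition for a single structure `A`. -/
def RecolouringWorksFor (Φ₁ : SNPSentence τ σ₁) (Φ₂ : SNPSentence τ σ₂) (n : ℕ)
    (ξ : ∀ p : (Σ k : ℕ, OrderedColour Φ₁ n k), OrderedColour Φ₂ n p.1)
    (A : CategoryTheory.Bundled.{0} (withLT (τ.sum σ₁)).Structure) : Prop :=
  ∃ S' : (withLT (τ.sum σ₂)).Structure A,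
    (⟨A, S'⟩ : CategoryTheory.Bundled.{0} (withLT (τ.sum σ₂)).Structure) ∈
      linOrdExpansions Φ₂.efm ∧
    (∀ a b : A, ltRel A.str a b ↔ ltRel S' a b) ∧
    ∀ (k : ℕ) (T : OrderedColour Φ₁ n k) (e : Fin k → A),
      IsEmbedding T.str A.str e → IsEmbedding (ξ ⟨k, T⟩).str S' e

variable {Φ₁ : SNPSentence τ σ₁} {Φ₂ : SNPSentence τ σ₂} {n : ℕ}

/-- The colour induced on `Fin k` by an embedding of a colour of `Φ₁` with the same order and the
same `τ`-reduct. -/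
theorem exists_orderedColour_str_eq {k : ℕ} (T : OrderedColour Φ₁ n k)
    {S' : (withLT (τ.sum σ₂)).Structure (Fin k)}
    (hS' : (⟨Fin k, S'⟩ : CategoryTheory.Bundled.{0} (withLT (τ.sum σ₂)).Structure) ∈
      linOrdExpansions Φ₂.efm)
    (hlt : ∀ a b, ltRel T.str a b ↔ ltRel S' a b)
    (hred : @LHom.reduct _ _ (SNPSentence.inclLT τ σ₂) (Fin k) S' =
      @LHom.reduct _ _ (SNPSentence.inclLT τ σ₁) (Fin k) T.str) :
    ∃ T' : OrderedColour Φ₂ n k, T'.str = S' := by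
  refine ⟨⟨S', T.size_le, hS', fun i j => (hlt i j).symm.trans (T.standard i j), ?_⟩, rfl⟩
  obtain ⟨m, R, t, hR, ht⟩ := T.guarded
  refine ⟨m, R, t, ?_, ht⟩
  have : (@LHom.reduct _ _ (SNPSentence.inclLT τ σ₂) (Fin k) S').RelMap R t := by
    rw [hred]
    exact hR
  exact this

variable [τ.IsRelational] [σ₂.IsRelational]

theorem RecolouringWorksFor.of_isEmbedding
    {ξ : ∀ p : (Σ k : ℕ, OrderedColour Φ₁ n k), OrderedColour Φ₂ n p.1}
    {A B : CategoryTheory.Bundled.{0} (withLT (τ.sum σ₁)).Structure}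
    (hB : RecolouringWorksFor Φ₁ Φ₂ n ξ B) {j : A → B} (hj : IsEmbedding A.str B.str j) :
    RecolouringWorksFor Φ₁ Φ₂ n ξ A := by
  obtain ⟨S', hmem, hlt, hS'⟩ := hB
  have hp := isEmbedding_pullback S' hj.injective
  refine ⟨pullback S' j, mem_linOrdExpansions_efm_of_isEmbedding hmem hp, fun a b => ?_,
    fun k T e he => hp.of_comp (hS' k T (j ∘ e) (hj.comp he))⟩
  rw [← hj.ltRel_iff, ← hp.ltRel_iff, hlt]

/-- If every finite model of `Φ₁` is a model of `Φ₂`, then every linearly ordered model of the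
first-order part of `Φ₁` has a counterpart for `Φ₂` with the same `τ`-reduct and order. -/
theorem exists_mem_linOrdExpansions_of_fm_subset (h : Φ₁.fm ⊆ Φ₂.fm)
    (A : CategoryTheory.Bundled.{0} (withLT (τ.sum σ₁)).Structure)
    (hA : A ∈ linOrdExpansions Φ₁.efm) :
    ∃ S' : (withLT (τ.sum σ₂)).Structure A,
      (⟨A, S'⟩ : CategoryTheory.Bundled.{0} (withLT (τ.sum σ₂)).Structure) ∈
        linOrdExpansions Φ₂.efm ∧
      (∀ a b : A, ltRel A.str a b ↔ ltRel S' a b) ∧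
      @LHom.reduct _ _ (SNPSentence.inclLT τ σ₂) A S' =
        @LHom.reduct _ _ (SNPSentence.inclLT τ σ₁) A A.str := by
  obtain ⟨⟨hfin, hFO⟩, hord⟩ := hA
  obtain ⟨-, S, hred, hS⟩ := h (show reduct (SNPSentence.inclLT τ σ₁) A ∈ Φ₁.fm from
    ⟨hfin, _, rfl, hFO⟩)
  refine ⟨withOrder S (ltRel A.str), ⟨⟨hfin, ?_⟩, hord⟩, fun _ _ => Iff.rfl,
    structure_ext fun k R t => ?_⟩
  · exact hS
  · have hRt := congrArg (fun M : τ.Structure A => M.RelMap R t) hred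
    exact iff_of_eq hRt

variable [σ₁.IsRelational]

theorem finite_orderedColour (Φ : SNPSentence τ σ₁) [Finite (Σ k : ℕ, τ.Relations k)]
    [Finite (Σ k : ℕ, σ₁.Relations k)] (n k : ℕ) : Finite (OrderedColour Φ n k) := by
  have := finite_relations_sum τ σ₁
  have := finite_relations_ltLang
  have := finite_relations_sum (τ.sum σ₁) ltLang
  have := finite_structure (L := withLT (τ.sum σ₁)) (Fin k)
  refine Finite.of_injective (fun T : OrderedColour Φ n k => T.str) fun T T' h => ?_
  cases T
  cases T'
  cases h
  rfl

/-- The size of a colour is at most `n`, and each size admits finitely many colours. -/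
theorem finite_sigma_orderedColour (Φ : SNPSentence τ σ₁) [Finite (Σ k : ℕ, τ.Relations k)]
    [Finite (Σ k : ℕ, σ₁.Relations k)] (n : ℕ) : Finite (Σ k : ℕ, OrderedColour Φ n k) := by
  have := finite_orderedColour Φ n
  refine Finite.of_injective (β := Σ k : Fin (n + 1), OrderedColour Φ n k)
    (fun p => ⟨⟨p.1, Nat.lt_succ_of_le p.2.size_le⟩, p.2⟩) ?_
  rintro ⟨k, T⟩ ⟨k', T'⟩ h
  obtain ⟨h, h'⟩ := Sigma.mk.inj h
  cases congrArg Fin.val h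
  cases h'
  rfl

variable [Finite (Σ k : ℕ, τ.Relations k)] [Finite (Σ k : ℕ, σ₁.Relations k)]
  [Finite (Σ k : ℕ, σ₂.Relations k)]

/-- The Ramsey argument for one model; the map obtained may depend on `A`. -/
theorem exists_recolouringWorksFor (hready : Φ₁.IsRecolouringReady) (h : Φ₁.fm ⊆ Φ₂.fm)
    (A : CategoryTheory.Bundled.{0} (withLT (τ.sum σ₁)).Structure)
    (hA : A ∈ linOrdExpansions Φ₁.efm) :
    ∃ ξ : ∀ p : (Σ k : ℕ, OrderedColour Φ₁ n k), OrderedColour Φ₂ n p.1,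
      (∀ p, @LHom.reduct _ _ (SNPSentence.inclLT τ σ₂) (Fin p.1) (ξ p).str =
        @LHom.reduct _ _ (SNPSentence.inclLT τ σ₁) (Fin p.1) p.2.str) ∧
      RecolouringWorksFor Φ₁ Φ₂ n ξ A := by
  obtain ⟨C, -, hhom, -, hRam, hage, hage', -⟩ := hready
  rw [hage'] at hage
  have := finite_sigma_orderedColour Φ₁ n
  have := finite_relations_sum τ σ₂
  have := finite_relations_ltLang
  have := finite_relations_sum (τ.sum σ₂) ltLang
  have hfin : ∀ p : (Σ k : ℕ, OrderedColour Φ₁ n k),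
      Finite ((withLT (τ.sum σ₂)).Structure (Fin p.1)) := fun p => finite_structure _
  obtain ⟨W, hW, hc⟩ := hRam.exists_forall_guarded hhom
    (fun p : (Σ k : ℕ, OrderedColour Φ₁ n k) => ⟨Fin p.1, p.2.str⟩)
    (fun p => by rw [hage]; exact p.2.mem) (fun p => p.2.guarded)
    (fun p => (withLT (τ.sum σ₂)).Structure (Fin p.1)) A (by rw [hage]; exact hA)
  rw [hage] at hW
  obtain ⟨S, hS, hlt, hred⟩ := exists_mem_linOrdExpansions_of_fm_subset h W hW
  -- A copy of a colour in `W` is coloured by the structure that `S` induces on it, transported to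
  -- `Fin k`.
  obtain ⟨e, he, hce⟩ := hc fun p u => pullback S u
  have hcol : ∀ p : (Σ k : ℕ, OrderedColour Φ₁ n k), ∃ T' : OrderedColour Φ₂ n p.1,
      @LHom.reduct _ _ (SNPSentence.inclLT τ σ₂) (Fin p.1) T'.str =
        @LHom.reduct _ _ (SNPSentence.inclLT τ σ₁) (Fin p.1) p.2.str ∧
      ∀ u : Fin p.1 → A, IsEmbedding p.2.str A.str u → T'.str = pullback S (e ∘ u) := by
    rintro ⟨k, T⟩
    by_cases hu : ∃ u : Fin k → A, IsEmbedding T.str A.str u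
    · obtain ⟨u, hu⟩ := hu
      have heu := he.comp hu
      have hp := isEmbedding_pullback S heu.injective
      have hr : @LHom.reduct _ _ (SNPSentence.inclLT τ σ₂) (Fin k) (pullback S (e ∘ u)) =
          @LHom.reduct _ _ (SNPSentence.inclLT τ σ₁) (Fin k) T.str := by
        refine structure_ext fun m R t => ?_
        rw [← (hp.reduct (SNPSentence.inclLT τ σ₂)).relMap_iff, hred]
        exact (heu.reduct (SNPSentence.inclLT τ σ₁)).relMap_iff R t
      obtain ⟨T', hT'⟩ := exists_orderedColour_str_eq (Φ₂ := Φ₂) T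
        (mem_linOrdExpansions_efm_of_isEmbedding (A := ⟨Fin k, _⟩) hS hp)
        (fun a b => by rw [← hp.ltRel_iff, ← hlt, heu.ltRel_iff]) hr
      refine ⟨T', by rw [hT']; exact hr, fun v hv => ?_⟩
      rw [hT']
      exact hce ⟨k, T⟩ u v hu hv
    -- A colour that does not occur in `A` may take any value with the right `τ`-reduct and order;
    -- containment applied to the colour itself supplies one.
    · obtain ⟨S', hS', hlt', hred'⟩ := exists_mem_linOrdExpansions_of_fm_subset h _ T.mem
      obtain ⟨T', rfl⟩ := exists_orderedColour_str_eq T hS' hlt' hred'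
      exact ⟨T', hred', fun u hu' => (hu ⟨u, hu'⟩).elim⟩
  choose ξ hξ hξ' using hcol
  have hp := isEmbedding_pullback S he.injective
  refine ⟨ξ, hξ, pullback S e, mem_linOrdExpansions_efm_of_isEmbedding hS hp, fun a b => ?_,
    fun k T u hu => ?_⟩
  · rw [← he.ltRel_iff, hlt, hp.ltRel_iff]
  · rw [hξ' ⟨k, T⟩ u hu]
    exact isEmbedding_iff.2 ⟨hu.injective, fun _ _ _ => Iff.rfl⟩

/-- A compactness argument replaced by finiteness: there are finitely many candidate maps, ages have
joint embeddings, and working for a model passes to its substructures. -/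
theorem exists_isGMSNPRecolouring_of_fm_subset (hready : Φ₁.IsRecolouringReady)
    (h : Φ₁.fm ⊆ Φ₂.fm) : ∃ ξ : ColourMap Φ₁ Φ₂, IsGMSNPRecolouring Φ₁ Φ₂ ξ := by
  let n := max Φ₁.ar Φ₂.ar
  let Ξ := {ξ : ∀ p : (Σ k : ℕ, OrderedColour Φ₁ n k), OrderedColour Φ₂ n p.1 //
    ∀ p, @LHom.reduct _ _ (SNPSentence.inclLT τ σ₂) (Fin p.1) (ξ p).str =
      @LHom.reduct _ _ (SNPSentence.inclLT τ σ₁) (Fin p.1) p.2.str}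
  have := finite_sigma_orderedColour Φ₁ n
  have := finite_orderedColour Φ₂ n
  have : Finite Ξ := Subtype.finite
  suffices hs : ∃ ξ : Ξ, ∀ A ∈ linOrdExpansions Φ₁.efm, RecolouringWorksFor Φ₁ Φ₂ n ξ.1 A by
    obtain ⟨ξ, hξ⟩ := hs
    exact ⟨fun k T => ξ.1 ⟨k, T⟩, fun k T => ξ.2 ⟨k, T⟩, hξ⟩
  by_contra! hbad
  choose A hA hAbad using hbad
  have hage : ∃ C : CategoryTheory.Bundled.{0} (withLT (τ.sum σ₁)).Structure,
      age C = linOrdExpansions Φ₁.efm := by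
    obtain ⟨C, -, -, -, -, hage, hage', -⟩ := hready
    exact ⟨C, by rw [hage, hage']⟩
  obtain ⟨C, hage⟩ := hage
  obtain ⟨B, hB, hAB⟩ := exists_mem_age_forall_isEmbedding C A fun ξ => by rw [hage]; exact hA ξ
  rw [hage] at hB
  obtain ⟨ξ, hξ, hw⟩ := exists_recolouringWorksFor (n := n) hready h B hB
  obtain ⟨f, hf⟩ := hAB ⟨ξ, hξ⟩
  exact hAbad ⟨ξ, hξ⟩ (hw.of_isEmbedding hf)

end Recolourings

/-! ### From a recolouring to containment. -/

section Containment

variable {τ σ₁ σ₂ : FirstOrder.Language.{0, 0}} [τ.IsRelational] [σ₁.IsRelational]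
  {Φ₁ : SNPSentence τ σ₁} {Φ₂ : SNPSentence τ σ₂} {n : ℕ}

/-- Every tuple in a `τ`-relation of a linearly ordered model of the first-order part lies in the
image of a colour. -/
theorem exists_orderedColour_isEmbedding
    {A : CategoryTheory.Bundled.{0} (withLT (τ.sum σ₁)).Structure}
    (hA : A ∈ linOrdExpansions Φ₁.efm) {m : ℕ} (hm : m ≤ n) (R : τ.Relations m) (t : Fin m → A)
    (hR : A.str.RelMap ((SNPSentence.inclLT τ σ₁).onRelation R) t) :
    ∃ (k : ℕ) (T : OrderedColour Φ₁ n k) (e : Fin k → A) (s : Fin m → Fin k),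
      IsEmbedding T.str A.str e ∧ e ∘ s = t := by
  classical
  have hord := hA.2
  let := linearOrderOfSTO (ltRel A.str)
  -- The colour is the structure induced on the entries of `t`, listed in increasing order; `t`
  -- itself witnesses that it is guarded, and repeated entries only shrink it below `m`.
  let F : Finset A := Finset.univ.image t
  let e : Fin F.card ↪o A := F.orderEmbOfFin rfl
  have hp := isEmbedding_pullback A.str e.injective
  have ht : ∀ i, ∃ j, e j = t i := fun i => by
    have : t i ∈ Set.range e := by
      rw [Finset.range_orderEmbOfFin]
      exact Finset.mem_coe.2 (Finset.mem_image_of_mem t (Finset.mem_univ i))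
    exact this
  choose s hs using ht
  have hs' : e ∘ s = t := funext hs
  refine ⟨F.card, ⟨pullback A.str e, ?_, mem_linOrdExpansions_efm_of_isEmbedding hA hp,
    fun i j => ?_, m, R, s, ?_, fun j => ?_⟩, e, s, hp, hs'⟩
  · exact (Finset.card_image_le.trans (by simp)).trans hm
  · rw [← hp.ltRel_iff]
    exact e.lt_iff_lt
  · rw [← hp.relMap_iff, hs']
    exact hR
  · have : e j ∈ F := Finset.orderEmbOfFin_mem F rfl j
    obtain ⟨i, -, hi⟩ := Finset.mem_image.1 this
    exact ⟨i, e.injective ((hs i).trans hi)⟩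

theorem fm_subset_of_isGMSNPRecolouring [Finite (Σ k : ℕ, τ.Relations k)]
    [Finite (Σ k : ℕ, σ₁.Relations k)] (hready : Φ₂.IsRecolouringReady) {ξ : ColourMap Φ₁ Φ₂}
    (hξ : IsGMSNPRecolouring Φ₁ Φ₂ ξ) : Φ₁.fm ⊆ Φ₂.fm := by
  have := finite_relations_sum τ σ₁
  rintro A ⟨hfin, S, hred, hS⟩
  let A' : CategoryTheory.Bundled.{0} (withLT (τ.sum σ₁)).Structure :=
    ⟨A, withOrder S WellOrderingRel⟩
  have hA' : A' ∈ linOrdExpansions Φ₁.efm :=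
    ⟨⟨hfin, hS⟩, inferInstanceAs (IsStrictTotalOrder A WellOrderingRel)⟩
  obtain ⟨S', hS', -, hemb⟩ := hξ.2 A' hA'
  have hmem : (⟨A, @LHom.reduct _ _ (SNPSentence.inclLT τ σ₂) A S'⟩ :
      CategoryTheory.Bundled.{0} τ.Structure) ∈ Φ₂.fm := ⟨hfin, _, rfl, hS'.1.2⟩
  -- Only one inclusion is shown: `S'` could have further `τ`-tuples on sets that no colour covers.
  -- Hence the passage through the CSP below.
  have hmap : ∀ (m : ℕ) (R : τ.Relations m) (t : Fin m → A), A.str.RelMap R t →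
      S'.RelMap ((SNPSentence.inclLT τ σ₂).onRelation R) t := by
    intro m R t hR
    rw [← hred] at hR
    have hm : m ≤ max Φ₁.ar Φ₂.ar :=
      (le_maxArity (L := τ.sum σ₁) (Sum.inl R)).trans (le_max_left _ _)
    obtain ⟨k, T, e, s, he, rfl⟩ := exists_orderedColour_isEmbedding hA' hm R t hR
    rw [(hemb k T e he).relMap_iff]
    have h : (@LHom.reduct _ _ (SNPSentence.inclLT τ σ₁) (Fin k) T.str).RelMap R s :=
      (he.relMap_iff _ s).1 hR
    rw [← hξ.1 k T] at h
    exact h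
  obtain ⟨C, -, -, -, -, -, -, -, hCSP⟩ := hready
  rw [← hCSP] at hmem ⊢
  obtain ⟨-, ⟨g⟩⟩ := hmem
  exact ⟨hfin, ⟨{ toFun := g, map_fun' := fun f => isEmptyElim f,
                  map_rel' := fun R t hR => g.map_rel' R t (hmap _ R t hR) }⟩⟩

end Containment

end GMSNP

theorem mainTheorem6 {τ σ₁ σ₂ : FirstOrder.Language.{0, 0}}
    [τ.IsRelational] [σ₁.IsRelational] [σ₂.IsRelational]
    [Finite (Σ k : ℕ, τ.Relations k)] [Finite (Σ k : ℕ, σ₁.Relations k)]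
    [Finite (Σ k : ℕ, σ₂.Relations k)]
    (Φ₁ : GMSNP.SNPSentence τ σ₁) (Φ₂ : GMSNP.SNPSentence τ σ₂)
    (hΦ₁ : Φ₁.IsGMSNP) (hΦ₂ : Φ₂.IsGMSNP)
    (hconn₁ : Φ₁.IsConnected) (hconn₂ : Φ₂.IsConnected)
    (hready₁ : Φ₁.IsRecolouringReady) (hready₂ : Φ₂.IsRecolouringReady) :
    Φ₁.fm ⊆ Φ₂.fm ↔
      ∃ ξ : GMSNP.ColourMap Φ₁ Φ₂, GMSNP.IsGMSNPRecolouring Φ₁ Φ₂ ξ :=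
  ⟨GMSNP.exists_isGMSNPRecolouring_of_fm_subset hready₁,
    fun ⟨_, hξ⟩ => GMSNP.fm_subset_of_isGMSNPRecolouring hready₂ hξ⟩
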